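/- Let $n\ge 1$ and $p\ge 1$ be integers, let $k$ be an integer, and put $N=2p$. Let $\Lambda_k=[\lambda_1,\dots,\lambda_N]$ be the non-ordered vector (multiset) given by $$\lambda_{1+j}=k+2j,\qquad \lambda_{1+p+j}=-n-k+2+2j\qquad (j=0,\dots,p-1).$$ Let $\phi=Q_N[\Lambda_k]$ be the associated TB-spline, i.e. the continuous function on $\mathbb{R}$ with Fourier transform $$\int_{\mathbb{R}}\phi(t)e^{-i\xi t}\,dt=\prod_{j=1}^{N}\frac{e^{-\lambda_j}-e^{-i\xi}}{i\xi-\lambda_j}$$ (extended by continuity at $\xi=0$ if some $\lambda_j=0$); equivalently, $\phi(t)=\frac{1}{2\pi}\int_{\mathbb{R}}e^{i\xi t}\prod_{j=1}^{N}\frac{e^{-\lambda_j}-e^{-i\xi}}{i\xi-\lambda_j}\,d\xi$. Put $$\phi^{*}(\xi)=\sum_{j\in\mathbb{Z}}\phi(j)e^{-i\xi j}\quad(\xi\in\mathbb{R}),\qquad \Phi_{N-1}[\Lambda_k](x;\lambda)=\sum_{j\in\mathbb{Z}}\lambda^{j}Q_N[\Lambda_k](x-j).$$ Then $\phi^{*}(\xi)\neq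 0$ for every $\xi\in\mathbb{R}$. Moreover, $\phi^{*}(\xi)=\Phi_{N-1}[\Lambda_k](0;e^{i\xi})$ for all $\xi\in\mathbb{R}$, so that $\Phi_{N-1}[\Lambda_k](0;\lambda)\neq 0$ for all $\lambda\in\mathbb{C}$ with $|\lambda|=1$. -/

import Mathlib

namespace ExpSpline

open Complex

/-- The symbol `∏_{λ ∈ Λ} (e^{-λ} - e^{-iξ}) / (iξ - λ)`, which is the Fourier transform
`ξ ↦ ∫ Q_N(t) e^{-iξt} dt` of the TB-spline of the non-ordered vector (multiset) `Λ`.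
A denominator can vanish only at the single point `ξ = 0` (when `0 ∈ Λ`), where the symbol has a
removable singularity; this point does not affect the integral in `tbSpline`. -/
noncomputable def tbSplineHat (Λ : Multiset ℝ) (ξ : ℝ) : ℂ :=
  (Λ.map fun l : ℝ =>
    (exp (-(l : ℂ)) - exp (-(I * (ξ : ℂ)))) / (I * (ξ : ℂ) - (l : ℂ))).prod

/-- The TB-spline `Q_N[Λ]`, defined through its Fourier transform `tbSplineHat Λ`:
`Q_N(t) = (1 / 2π) ∫ e^{iξt} Q̂_N(ξ) dξ`. For `N = card Λ ≥ 2` the symbol is bounded near every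
point and is `O(|ξ|^{-N})`, so the integral converges absolutely. -/
noncomputable def tbSpline (Λ : Multiset ℝ) (t : ℝ) : ℂ :=
  (1 / (2 * (Real.pi : ℂ))) * ∫ ξ : ℝ, exp (I * (ξ : ℂ) * (t : ℂ)) * tbSplineHat Λ ξ

/-- The Euler-Schoenberg exponential spline `Φ_{N-1}[Λ](x; z) = ∑_{j ∈ ℤ} z^j Q_N(x - j)`. -/
noncomputable def eulerSchoenberg (Λ : Multiset ℝ) (x : ℝ) (z : ℂ) : ℂ :=
  ∑' j : ℤ, z ^ j * tbSpline Λ (x - (j : ℝ))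

/-- `φ*(ξ) = ∑_{j ∈ ℤ} φ(j) e^{-iξj}` for a function `φ` on the real line. -/
noncomputable def phiStar (φ : ℝ → ℂ) (ξ : ℝ) : ℂ :=
  ∑' j : ℤ, φ (j : ℝ) * exp (-(I * (ξ : ℂ) * (j : ℂ)))

/-- The nearly symmetric vector `Λ_k` of order `2p` in dimension `n`: the numbers `k + 2j` and
`-n - k + 2 + 2j` for `j = 0, …, p - 1`, with repetitions counted. -/
noncomputable def nearlySymmetric (n p : ℕ) (k : ℤ) : Multiset ℝ :=
  ((Multiset.range p).map fun j : ℕ => (k : ℝ) + 2 * (j : ℝ)) +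
    ((Multiset.range p).map fun j : ℕ => -(n : ℝ) - (k : ℝ) + 2 + 2 * (j : ℝ))

end ExpSpline

/-! On `[0, 1]` let F_z(x) = ∑ z^j Q(x + j), which is `period`; then Φ(0; z) = F_{1/z}(0). Adding a
node l to the spline replaces F by the solution G of G' - lG = (e^{-l} - z)F with G(0) = zG(1), so
everything can be proved by induction on the nodes. Three cases cover the unit circle.

If z is not real, any real nodes will do: for Im z > 0 the argument of F_z decreases along `[0, 1]`
by at most arg z, this property survives each step, and it forces F_z(0) ≠ 0
(`TurnsWithin.average`). Conjugation gives Im z < 0. If z = 1, positivity is enough.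

Only z = -1 uses the nodes. There F(0) is a nonzero multiple of the divided difference of 1/(1 +
e^l) over the nodes. These are integers of multiplicity at most two, so this is the value at e of a
rational function over ℚ. As e is transcendental, a zero value would make the function itself zero.
Let L be the largest absolute value of a node. At ζ = exp(πi/L) only the nodes ±L can produce poles,
and their leading coefficients cannot cancel: the number of inner nodes is even, which fixes the
relative sign of the coefficients at the two extreme nodes (`period_neg_one_simple_ne_zero`,
`period_neg_one_double_ne_zero`).

The Fourier transform sees only the multiset, so the nodes may be added in whichever order is
convenient. -/

namespace ExpSpline

open Complex

/-! ### Transcendence of e and regularity of rational functions at a point. -/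

section Transcendence

open Polynomial Filter Topology
open scoped Nat

/-- An integer polynomial with nonzero constant coefficient does not vanish at `e`. -/
theorem aeval_exp_one_ne_zero_of_coeff_zero_ne_zero (P : ℤ[X]) (hP : P.coeff 0 ≠ 0) :
    aeval (exp 1) P ≠ 0 := by
  intro h0
  set d := P.natDegree with hd
  set f : ℤ[X] := ∏ i ∈ Finset.range d, (X - C ((i : ℤ) + 1)) with hf
  have hfm : f.Monic := monic_prod_of_monic _ _ fun i _ => monic_X_sub_C _
  have hf0 : f.eval 0 ≠ 0 := by
    rw [hf, eval_prod, Finset.prod_ne_zero_iff]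
    intro i _
    simp only [eval_sub, eval_X, eval_C]
    omega
  obtain ⟨c, hc⟩ := LindemannWeierstrass.exp_polynomial_approx f hf0
  set A : ℝ := ∑ i ∈ Finset.range d, |(P.coeff (i + 1) : ℝ)| with hA
  -- Hermite's contradiction: with n e^{i+1} ≈ p g(i+1), the relation P(e) = 0 yields an integer
  -- that is nonzero modulo p, yet bounded by a quantity tending to 0.
  have key : ∀ p > max (eval 0 f).natAbs (P.coeff 0).natAbs, p.Prime →
      1 ≤ A * (c ^ p / (p - 1)!) := by
    intro p hp hpp
    obtain ⟨n, hn, g, -, hg⟩ := hc p (lt_of_le_of_lt (le_max_left _ _) hp) hpp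
    set Z : ℤ := n * P.coeff 0 + p * ∑ i ∈ Finset.range d, P.coeff (i + 1) * g.eval ((i : ℤ) + 1)
      with hZ
    have hZ0 : Z ≠ 0 := by
      intro h
      have h1 : (p : ℤ) ∣ n * P.coeff 0 := by
        have : n * P.coeff 0 =
          p * -∑ i ∈ Finset.range d, P.coeff (i + 1) * g.eval ((i : ℤ) + 1) := by
          linarith [hZ.symm.trans h]
        exact ⟨_, this⟩
      rcases Int.Prime.dvd_mul' hpp h1 with h2 | h2
      · exact hn h2
      · have h3 := Int.natAbs_dvd_natAbs.mpr h2
        have h4 := Nat.le_of_dvd (Int.natAbs_pos.mpr hP) h3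
        have := lt_of_le_of_lt (le_max_right _ _) hp
        simp at h4
        omega
    have hroot : ∀ i ∈ Finset.range d, ((i : ℂ) + 1) ∈ f.aroots ℂ := by
      intro i hi
      rw [mem_aroots]
      refine ⟨hfm.ne_zero, ?_⟩
      rw [hf, map_prod]
      exact Finset.prod_eq_zero hi (by simp)
    have hsum : (n : ℂ) * P.coeff 0 +
        ∑ i ∈ Finset.range d, (P.coeff (i + 1) : ℂ) * (n * exp ((i : ℂ) + 1)) = 0 := by
      rw [aeval_eq_sum_range, Finset.sum_range_succ'] at h0
      simp only [zsmul_eq_mul, pow_zero, mul_one, ← Complex.exp_nat_mul] at h0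
      push_cast at h0
      have := congrArg (fun w => (n : ℂ) * w) h0
      simp only [mul_add, mul_zero, Finset.mul_sum] at this
      rw [← this, add_comm]
      congr 1
      exact Finset.sum_congr rfl fun i _ => by ring
    have heq : (Z : ℂ) = -∑ i ∈ Finset.range d, (P.coeff (i + 1) : ℂ) *
        (n • exp ((i : ℂ) + 1) - p • aeval ((i : ℂ) + 1) g) := by
      have h1 : ∀ i : ℕ, aeval ((i : ℂ) + 1) g = ((g.eval ((i : ℤ) + 1) : ℤ) : ℂ) := by
        intro i
        have := aeval_algebraMap_apply_eq_algebraMap_eval (A := ℂ) ((i : ℤ) + 1) g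
        simpa using this
      simp only [h1, mul_sub, Finset.sum_sub_distrib, hZ, nsmul_eq_mul, zsmul_eq_mul]
      push_cast
      have h2 : (n : ℂ) * P.coeff 0 =
        -∑ i ∈ Finset.range d, (P.coeff (i + 1) : ℂ) * (n * exp ((i : ℂ) + 1)) :=
          eq_neg_of_add_eq_zero_left hsum
      rw [h2, Finset.mul_sum, neg_sub, sub_eq_add_neg, add_comm]
      congr 1
      exact Finset.sum_congr rfl fun i _ => by ring
    have hbound : ‖(Z : ℂ)‖ ≤ A * (c ^ p / (p - 1)!) := by
      rw [heq, norm_neg, hA, Finset.sum_mul]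
      refine (norm_sum_le _ _).trans (Finset.sum_le_sum fun i hi => ?_)
      rw [norm_mul]
      refine mul_le_mul (by simp) (hg (hroot i hi)) (norm_nonneg _) (abs_nonneg _)
    refine le_trans ?_ hbound
    rw [Complex.norm_intCast]
    exact_mod_cast Int.one_le_abs hZ0
  have hlim : Tendsto (fun n : ℕ => A * (c * (c ^ n / n !))) atTop (𝓝 0) := by
    have := ((FloorSemiring.tendsto_pow_div_factorial_atTop c).const_mul c).const_mul A
    simpa using this
  obtain ⟨m, hm⟩ := eventually_atTop.mp (hlim.eventually_lt_const one_pos)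
  obtain ⟨p, hp1, hp2⟩ := Nat.exists_infinite_primes
    (m + max (eval 0 f).natAbs (P.coeff 0).natAbs + 1)
  have h1 := key p (by omega) hp2
  obtain ⟨q, rfl⟩ : ∃ q, p = q + 1 := ⟨p - 1, by have := hp2.pos; omega⟩
  have h2 := hm q (by omega)
  rw [Nat.add_sub_cancel, pow_succ', mul_div_assoc] at h1
  linarith

/-- Hermite's theorem: `e` is transcendental. -/
theorem transcendental_exp_one : Transcendental ℚ (exp 1) := by
  rw [Transcendental, ← IsFractionRing.isAlgebraic_iff ℤ ℚ ℂ]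
  rintro ⟨P, hP, h⟩
  -- Dividing out the power of X makes the constant coefficient nonzero.
  obtain ⟨Q, hQ, hdvd⟩ := exists_eq_pow_rootMultiplicity_mul_and_not_dvd P hP 0
  rw [hQ, map_mul, map_pow] at h
  simp only [map_zero, sub_zero, aeval_X, mul_eq_zero, pow_eq_zero_iff', exp_ne_zero,
    false_and, false_or] at h
  refine aeval_exp_one_ne_zero_of_coeff_zero_ne_zero Q ?_ h
  rwa [map_zero, sub_zero, X_dvd_iff] at hdvd

/-- `v` is the value at `e` of a rational function over `ℚ` that has no pole at `ζ`. -/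
def IsRegularValue (ζ v : ℂ) : Prop :=
  ∃ a b : ℚ[X], aeval ζ b ≠ 0 ∧ v * aeval (exp 1) b = aeval (exp 1) a

theorem IsRegularValue.zero (ζ : ℂ) : IsRegularValue ζ 0 := ⟨0, 1, by simp, by simp⟩

theorem IsRegularValue.add {ζ v w : ℂ} (hv : IsRegularValue ζ v) (hw : IsRegularValue ζ w) :
    IsRegularValue ζ (v + w) := by
  obtain ⟨a, b, hb, h⟩ := hv
  obtain ⟨a', b', hb', h'⟩ := hw
  refine ⟨a * b' + a' * b, b * b', by rw [map_mul]; exact mul_ne_zero hb hb', ?_⟩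
  simp only [map_mul, map_add, ← h, ← h']
  ring

theorem IsRegularValue.rat_mul {ζ v : ℂ} (hv : IsRegularValue ζ v) (r : ℚ) :
    IsRegularValue ζ (r * v) := by
  obtain ⟨a, b, hb, h⟩ := hv
  refine ⟨C r * a, b, hb, ?_⟩
  rw [map_mul, ← h, aeval_C, mul_assoc, eq_ratCast]

theorem IsRegularValue.sum {ι : Type*} {ζ : ℂ} (s : Finset ι) (v : ι → ℂ)
    (h : ∀ i ∈ s, IsRegularValue ζ (v i)) : IsRegularValue ζ (∑ i ∈ s, v i) :=
  Finset.sum_induction v _ (fun _ _ => IsRegularValue.add) (IsRegularValue.zero ζ) h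

/-- If the value at `e` of `C / (1 + X ^ L) ^ k` is also the value of a rational function regular at
a root `ζ` of `1 + X ^ L`, then `C` vanishes at `ζ`. -/
theorem aeval_eq_zero_of_isRegularValue {ζ v : ℂ} (hv : IsRegularValue ζ v) {L k : ℕ} (hk : k ≠ 0)
    (hζ : ζ ^ L = -1) (P : ℚ[X]) (h : v * (1 + exp 1 ^ L) ^ k = aeval (exp 1) P) :
    aeval ζ P = 0 := by
  obtain ⟨a, b, hb, hab⟩ := hv
  -- Transcendence lifts the equality of values at e to polynomials, which can then be evaluated at
  -- ζ.
  have h1 : P * b = (1 + X ^ L) ^ k * a := by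
    refine transcendental_iff_injective.mp transcendental_exp_one ?_
    simp only [map_mul, map_pow, map_add, map_one, aeval_X, ← h, ← hab]
    ring
  have h2 := congrArg (aeval ζ) h1
  simp only [map_mul, map_pow, map_add, map_one, aeval_X, hζ] at h2
  rw [add_neg_cancel, zero_pow hk, zero_mul] at h2
  exact (mul_eq_zero.mp h2).resolve_right hb

end Transcendence

/-! ### Poles of the sigmoid values at ζ = exp(πi/L). -/

section Poles

open Polynomial

theorem exp_pi_div_pow_self {L : ℕ} (hL : L ≠ 0) : exp (Real.pi * I / L) ^ L = -1 := by
  rw [← Complex.exp_nat_mul, mul_div_cancel₀ _ (Nat.cast_ne_zero.mpr hL), Complex.exp_pi_mul_I]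

/-- ζ^d = -1 would make d an odd multiple of L. Hence only the nodes ±L produce poles at ζ. -/
theorem one_add_exp_pi_div_pow_ne_zero {L d : ℕ} (hd : d < L) :
    1 + exp (Real.pi * I / L) ^ d ≠ 0 := by
  intro h
  have h1 : exp (d * (Real.pi * I / L)) = exp (Real.pi * I) := by
    rw [Complex.exp_nat_mul, Complex.exp_pi_mul_I]
    linear_combination h
  obtain ⟨n, hn⟩ := Complex.exp_eq_exp_iff_exists_int.mp h1
  have hL : (L : ℂ) ≠ 0 := Nat.cast_ne_zero.mpr (by omega)
  have hpi : (Real.pi : ℂ) * I ≠ 0 :=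
    mul_ne_zero (ofReal_ne_zero.mpr Real.pi_ne_zero) I_ne_zero
  have h2 : (d : ℂ) = L + 2 * n * L := by
    field_simp at hn
    apply mul_left_cancel₀ hpi
    linear_combination (Real.pi * I) * hn
  have h3 : (d : ℤ) = L + 2 * n * L := by exact_mod_cast h2
  rcases lt_or_ge n 0 with h | h <;> nlinarith

theorem one_add_exp_int_ne_zero (l : ℤ) : 1 + exp (l : ℂ) ≠ 0 := by
  have : 1 + exp (l : ℂ) = ((1 + Real.exp l : ℝ) : ℂ) := by push_cast; rfl
  rw [this, ofReal_ne_zero]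
  positivity

theorem exp_natCast (d : ℕ) : exp (d : ℂ) = exp 1 ^ d := by
  rw [← Complex.exp_nat_mul, mul_one]

/-- The function `1 / (1 + e ^ l)` of an integer node `l`. -/
noncomputable def sigmoid (l : ℤ) : ℂ := 1 / (1 + exp (l : ℂ))

/-- The opposite of the derivative of the sigmoid function. -/
noncomputable def sigmoidDeriv (l : ℤ) : ℂ := exp (l : ℂ) / (1 + exp (l : ℂ)) ^ 2

theorem sigmoid_neg (l : ℤ) : sigmoid (-l) = exp (l : ℂ) / (1 + exp (l : ℂ)) := by
  have h1 := one_add_exp_int_ne_zero l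
  have h2 := one_add_exp_int_ne_zero (-l)
  rw [sigmoid, div_eq_div_iff h2 h1]
  push_cast
  rw [exp_neg]
  field_simp
  ring

theorem sigmoidDeriv_neg (l : ℤ) : sigmoidDeriv (-l) = sigmoidDeriv l := by
  have h1 := one_add_exp_int_ne_zero l
  have h2 := one_add_exp_int_ne_zero (-l)
  rw [sigmoidDeriv, sigmoidDeriv, div_eq_div_iff (pow_ne_zero 2 h2) (pow_ne_zero 2 h1)]
  push_cast
  rw [exp_neg]
  field_simp
  ring

theorem isRegularValue_sigmoid {L : ℕ} {l : ℤ} (hl : l ∈ Finset.Ioo (-(L : ℤ)) L) :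
    IsRegularValue (exp (Real.pi * I / L)) (sigmoid l) := by
  rw [Finset.mem_Ioo] at hl
  obtain ⟨d, rfl | rfl⟩ := l.eq_nat_or_neg
  · have h1 := one_add_exp_int_ne_zero d
    refine ⟨1, 1 + X ^ d, ?_, ?_⟩
    · simpa using one_add_exp_pi_div_pow_ne_zero (show d < L by omega)
    · rw [sigmoid]
      simp only [map_add, map_one, map_pow, aeval_X, Int.cast_natCast, exp_natCast] at h1 ⊢
      field_simp
  · have h1 := one_add_exp_int_ne_zero d
    refine ⟨X ^ d, 1 + X ^ d, ?_, ?_⟩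
    · simpa using one_add_exp_pi_div_pow_ne_zero (show d < L by omega)
    · rw [sigmoid_neg]
      simp only [map_add, map_one, map_pow, aeval_X, Int.cast_natCast, exp_natCast] at h1 ⊢
      field_simp

theorem isRegularValue_sigmoidDeriv {L : ℕ} {l : ℤ} (hl : l ∈ Finset.Ioo (-(L : ℤ)) L) :
    IsRegularValue (exp (Real.pi * I / L)) (sigmoidDeriv l) := by
  rw [Finset.mem_Ioo] at hl
  obtain ⟨d, hd, h⟩ : ∃ d : ℕ, d < L ∧ sigmoidDeriv l = sigmoidDeriv d := by
    obtain ⟨d, rfl | rfl⟩ := l.eq_nat_or_neg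
    · exact ⟨d, by omega, rfl⟩
    · exact ⟨d, by omega, sigmoidDeriv_neg _⟩
  have h1 := one_add_exp_int_ne_zero d
  refine ⟨X ^ d, (1 + X ^ d) ^ 2, ?_, ?_⟩
  · simpa using one_add_exp_pi_div_pow_ne_zero hd
  · rw [h, sigmoidDeriv]
    simp only [map_add, map_one, map_pow, aeval_X, Int.cast_natCast, exp_natCast] at h1 ⊢
    field_simp

theorem sum_Icc_neg_eq {L : ℕ} (hL : L ≠ 0) (f : ℤ → ℂ) :
    ∑ l ∈ Finset.Icc (-(L : ℤ)) L, f l =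
      ∑ l ∈ Finset.Ioo (-(L : ℤ)) L, f l + f L + f (-L) := by
  have h : Finset.Icc (-(L : ℤ)) L =
      insert (-(L : ℤ)) (insert (L : ℤ) (Finset.Ioo (-(L : ℤ)) L)) := by
    ext l
    simp only [Finset.mem_Icc, Finset.mem_insert, Finset.mem_Ioo]
    omega
  rw [h, Finset.sum_insert, Finset.sum_insert]
  · ring
  · simp
  · simp only [Finset.mem_insert, Finset.mem_Ioo]
    omega

theorem isRegularValue_sum_Ioo {L : ℕ} (α β : ℤ → ℚ) :
    IsRegularValue (exp (Real.pi * I / L))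
      (∑ l ∈ Finset.Ioo (-(L : ℤ)) L, ((α l : ℂ) * sigmoid l - β l * sigmoidDeriv l)) := by
  refine IsRegularValue.sum _ _ fun l hl => ?_
  have := ((isRegularValue_sigmoid hl).rat_mul (α l)).add
    ((isRegularValue_sigmoidDeriv hl).rat_mul (-β l))
  convert this using 1
  push_cast
  ring

/-- A vanishing rational combination of values of the sigmoid function and its derivative at
integers has no double pole at the outermost integers. -/
theorem double_coeff_add_eq_zero {L : ℕ} (hL : L ≠ 0) (α β : ℤ → ℚ)
    (h : ∑ l ∈ Finset.Icc (-(L : ℤ)) L, ((α l : ℂ) * sigmoid l - β l * sigmoidDeriv l) = 0) :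
    β L + β (-L) = 0 := by
  rw [sum_Icc_neg_eq hL, sigmoid_neg, sigmoidDeriv_neg, sigmoid, sigmoidDeriv] at h
  have h1 := one_add_exp_int_ne_zero L
  have h2 := aeval_eq_zero_of_isRegularValue (isRegularValue_sum_Ioo (L := L) α β) two_ne_zero
    (exp_pi_div_pow_self hL)
    -- Numerator over (1 + X^L)^2 of the terms at ±L, moved across the equation. At X^L = -1 only
    -- the β part remains.
    (C (β L + β (-L)) * X ^ L - (C (α L) + C (α (-L)) * X ^ L) * (1 + X ^ L)) (by
      simp only [Int.cast_natCast, exp_natCast] at h h1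
      simp only [map_sub, map_add, map_mul, map_one, map_pow, aeval_X, aeval_C, eq_ratCast]
      field_simp at h
      linear_combination h)
  simp only [map_sub, map_add, map_mul, map_one, map_pow, aeval_X, aeval_C, eq_ratCast,
    exp_pi_div_pow_self hL] at h2
  have h3 : ((β L + β (-L) : ℚ) : ℂ) = 0 := by push_cast; linear_combination -h2
  exact_mod_cast h3

/-- A vanishing rational combination of values of the sigmoid function and its derivative at
integers, without derivatives at the outermost integers, has no simple pole there. -/
theorem simple_coeff_eq {L : ℕ} (hL : L ≠ 0) (α β : ℤ → ℚ) (h₁ : β L = 0) (h₂ : β (-L) = 0)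
    (h : ∑ l ∈ Finset.Icc (-(L : ℤ)) L, ((α l : ℂ) * sigmoid l - β l * sigmoidDeriv l) = 0) :
    α L = α (-L) := by
  rw [sum_Icc_neg_eq hL, sigmoid_neg, h₁, h₂, sigmoid] at h
  have h1 := one_add_exp_int_ne_zero L
  have h2 := aeval_eq_zero_of_isRegularValue (isRegularValue_sum_Ioo (L := L) α β) one_ne_zero
    -- The terms at L and -L have numerators α(L) and α(-L) X^L over 1 + X^L, so X^L = -1 leaves
    -- their difference.
    (exp_pi_div_pow_self hL) (-(C (α L) + C (α (-L)) * X ^ L)) (by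
      simp only [Int.cast_natCast, exp_natCast] at h h1
      simp only [map_neg, map_add, map_mul, map_pow, aeval_X, aeval_C, eq_ratCast]
      field_simp at h
      push_cast at h
      linear_combination h)
  simp only [map_neg, map_add, map_mul, map_pow, aeval_X, aeval_C, eq_ratCast,
    exp_pi_div_pow_self hL] at h2
  have h3 : (α L : ℂ) = α (-L) := by linear_combination -h2
  exact_mod_cast h3

end Poles

/-! ### The recursion for one period. -/

/-- The passage from one period of an exponential spline of order `N` to order `N + 1` by
convolution with `e ^ (l (t - 1))` on `[0, 1]`. -/
noncomputable def periodStep (z : ℂ) (l : ℝ) (F : ℝ → ℂ) (x : ℝ) : ℂ :=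
  exp (l * (x - 1)) * (∫ u in (0 : ℝ)..x, exp (-(l * u)) * F u) +
    z * exp (l * x) * ∫ u in x..1, exp (-(l * u)) * F u

/-- The function `x ↦ ∑ j, z ^ j * Q(x + j)` on `[0, 1]` for the TB-spline `Q` of `l₀ :: L`. -/
noncomputable def period (z : ℂ) (l₀ : ℝ) : List ℝ → ℝ → ℂ
  | [] => fun x => exp (l₀ * (x - 1))
  | l :: L => periodStep z l (period z l₀ L)

/-! ### The case z = -1 as an antiperiodic boundary problem. -/

section Antiperiodic

/-- The solution of the antiperiodic boundary problem for one exponential. -/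
noncomputable def expBase (l : ℤ) (x : ℝ) : ℂ := exp (l * x) / (1 + exp (l : ℂ))

/-- The derivative of `expBase l x` with respect to `l`. -/
noncomputable def expBaseDeriv (l : ℤ) (x : ℝ) : ℂ :=
  (x * exp (l * x) * (1 + exp (l : ℂ)) - exp (l * x) * exp (l : ℂ)) / (1 + exp (l : ℂ)) ^ 2

theorem hasDerivAt_exp_int_mul (l : ℤ) (x : ℝ) :
    HasDerivAt (fun x : ℝ => exp ((l : ℂ) * x)) (l * exp (l * x)) x := by
  have h := (ofRealCLM.hasDerivAt (x := x)).const_mul (l : ℂ)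
  simpa [mul_comm] using h.cexp

theorem hasDerivAt_expBase (l : ℤ) (x : ℝ) :
    HasDerivAt (expBase l) (l * expBase l x) x := by
  have := (hasDerivAt_exp_int_mul l x).div_const (1 + exp (l : ℂ))
  rwa [mul_div_assoc] at this

theorem hasDerivAt_expBaseDeriv (l : ℤ) (x : ℝ) :
    HasDerivAt (expBaseDeriv l) (l * expBaseDeriv l x + expBase l x) x := by
  have h0 := hasDerivAt_exp_int_mul l x
  have h1 : HasDerivAt (fun x : ℝ => (x : ℂ)) 1 x := ofRealCLM.hasDerivAt (x := x)
  have h2 := (((h1.mul h0).mul_const (1 + exp (l : ℂ))).sub (h0.mul_const (exp (l : ℂ)))).div_const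
    ((1 + exp (l : ℂ)) ^ 2)
  refine h2.congr_deriv ?_
  have := one_add_exp_int_ne_zero l
  rw [expBase, expBaseDeriv]
  field_simp
  ring

theorem expBase_zero_add_one (l : ℤ) : expBase l 0 + expBase l 1 = 1 := by
  have := one_add_exp_int_ne_zero l
  simp only [expBase, ofReal_zero, ofReal_one, mul_zero, mul_one, exp_zero]
  field_simp

theorem expBaseDeriv_zero_add_one (l : ℤ) : expBaseDeriv l 0 + expBaseDeriv l 1 = 0 := by
  simp only [expBaseDeriv, ofReal_zero, ofReal_one, mul_zero, mul_one, exp_zero]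
  ring

theorem expBase_zero (l : ℤ) : expBase l 0 = sigmoid l := by simp [expBase, sigmoid]

theorem expBaseDeriv_zero (l : ℤ) : expBaseDeriv l 0 = -sigmoidDeriv l := by
  simp [expBaseDeriv, sigmoidDeriv, neg_div]

/-- `periodStep` at `z = -1` solves the antiperiodic boundary problem for `D - μ`. -/
theorem periodStep_neg_one_eq (μ : ℤ) {F G : ℝ → ℂ} (hF : Continuous F)
    (hG : ∀ x, HasDerivAt G (μ * G x + F x) x) (h01 : G 0 + G 1 = 0) (x : ℝ) :
    periodStep (-1) μ F x = (1 + exp (-(μ : ℂ))) * G x := by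
  have hH : ∀ u : ℝ, HasDerivAt (fun u : ℝ => exp (-((μ : ℝ) * u : ℂ)) * G u)
      (exp (-((μ : ℝ) * u : ℂ)) * F u) u := by
    intro u
    have h1 := (hasDerivAt_exp_int_mul (-μ) u).mul (hG u)
    simp only [Int.cast_neg, neg_mul] at h1
    simp only [ofReal_intCast]
    exact h1.congr_deriv (by ring)
  have hint : ∀ a b : ℝ, ∫ u in a..b, exp (-((μ : ℝ) * u : ℂ)) * F u =
      exp (-((μ : ℝ) * b : ℂ)) * G b - exp (-((μ : ℝ) * a : ℂ)) * G a := fun a b =>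
    intervalIntegral.integral_eq_sub_of_hasDerivAt (fun u _ => hH u)
      (Continuous.intervalIntegrable (by fun_prop) _ _)
  rw [periodStep, hint, hint]
  simp only [ofReal_intCast, ofReal_zero, ofReal_one, mul_zero, neg_zero, exp_zero, mul_one,
    one_mul, mul_sub, sub_eq_add_neg (μ * x : ℂ) μ, exp_neg]
  have h1 : exp ((μ : ℂ) * x) ≠ 0 := exp_ne_zero _
  have h2 : exp (μ : ℂ) ≠ 0 := exp_ne_zero _
  simp only [exp_add, exp_neg]
  field_simp
  linear_combination -exp ((μ : ℂ) * x) * h01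

/-- `F` is a nonzero multiple of the combination of the functions `expBase` and `expBaseDeriv` with
rational coefficients `α` and `β`. -/
def HasExpansion (S : Finset ℤ) (α β : ℤ → ℚ) (F : ℝ → ℂ) : Prop :=
  ∃ c : ℂ, c ≠ 0 ∧
    ∀ x, F x = c * ∑ l ∈ S, ((α l : ℂ) * expBase l x + β l * expBaseDeriv l x)

/-- The simple coefficients of a divided difference after adding the node `μ`, away from `μ`. -/
def addNodeAux (α β : ℤ → ℚ) (μ l : ℤ) : ℚ := α l / (l - μ) - β l / (l - μ) ^ 2

/-- The simple coefficients of a divided difference after adding the node `μ`. -/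
def addNodeSimple (S : Finset ℤ) (α β : ℤ → ℚ) (μ : ℤ) : ℤ → ℚ :=
  Function.update (addNodeAux α β μ) μ (-∑ l ∈ S, addNodeAux α β μ l)

/-- The derivative coefficients of a divided difference after adding the node `μ`. -/
def addNodeDouble (α β : ℤ → ℚ) (μ : ℤ) : ℤ → ℚ :=
  Function.update (fun l => β l / (l - μ)) μ (α μ)

/-- Each term is solved separately: division by l - μ for l ≠ μ, and differentiation in the node for
l = μ. The condition `β μ = 0` keeps multiplicities at most two, so no second derivative appears. -/
theorem HasExpansion.periodStep {S : Finset ℤ} {α β : ℤ → ℚ} {F : ℝ → ℂ}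
    (h : HasExpansion S α β F) {μ : ℤ} (hμ : μ ∈ S) (hβ : β μ = 0) :
    HasExpansion S (addNodeSimple S α β μ) (addNodeDouble α β μ) (periodStep (-1) μ F) := by
  obtain ⟨c, hc, hF⟩ := h
  -- Division by zero gives 0 here, so the sum defining `addNodeSimple` at μ effectively omits μ.
  have hself : addNodeAux α β μ μ = 0 := by simp [addNodeAux]
  -- Subtracting `expBase μ`, a solution of the homogeneous equation, makes every term antiperiodic.
  set T : ℤ → ℝ → ℂ := fun l x => (addNodeAux α β μ l : ℂ) * (expBase l x - expBase μ x) +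
    addNodeDouble α β μ l * expBaseDeriv l x with hT
  have hTsum : ∀ x, ∑ l ∈ S, ((addNodeSimple S α β μ l : ℂ) * expBase l x +
      addNodeDouble α β μ l * expBaseDeriv l x) = ∑ l ∈ S, T l x := by
    intro x
    simp only [hT, Finset.sum_add_distrib]
    congr 1
    rw [← Finset.add_sum_erase _ _ hμ, ← Finset.add_sum_erase _ (fun l =>
      (addNodeAux α β μ l : ℂ) * (expBase l x - expBase μ x)) hμ, addNodeSimple,
      Function.update_self, ← Finset.add_sum_erase _ _ hμ, hself]
    simp only [sub_self, mul_zero, zero_add, mul_sub, Finset.sum_sub_distrib, Rat.cast_neg,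
      Rat.cast_sum, ← Finset.sum_mul]
    have hupd : ∀ l ∈ S.erase μ, (Function.update (addNodeAux α β μ) μ
        (-∑ l ∈ S.erase μ, addNodeAux α β μ l) l : ℂ) * expBase l x =
        addNodeAux α β μ l * expBase l x := fun l hl => by
      rw [Function.update_of_ne (Finset.ne_of_mem_erase hl)]
    rw [Finset.sum_congr rfl hupd]
    ring
  have hTderiv : ∀ l x, HasDerivAt (T l)
      (μ * T l x + ((α l : ℂ) * expBase l x + β l * expBaseDeriv l x)) x := by
    intro l x
    have h1 := (((hasDerivAt_expBase l x).sub (hasDerivAt_expBase μ x)).const_mul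
      (addNodeAux α β μ l : ℂ)).add
      ((hasDerivAt_expBaseDeriv l x).const_mul (addNodeDouble α β μ l : ℂ))
    refine h1.congr_deriv ?_
    by_cases hl : l = μ
    · subst hl
      simp only [hT, hself, hβ, addNodeDouble, Function.update_self]
      push_cast
      ring
    · have hne : (l : ℂ) - μ ≠ 0 := sub_ne_zero.mpr (by exact_mod_cast hl)
      simp only [hT, addNodeAux, addNodeDouble, Function.update_of_ne hl]
      push_cast
      field_simp
      ring
  have hT01 : ∀ l, T l 0 + T l 1 = 0 := by
    intro l
    simp only [hT]
    linear_combination (addNodeAux α β μ l : ℂ) * (expBase_zero_add_one l - expBase_zero_add_one μ)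
      + (addNodeDouble α β μ l : ℂ) * expBaseDeriv_zero_add_one l
  have hFcont : Continuous F := by
    have : F = fun x => c * ∑ l ∈ S, ((α l : ℂ) * expBase l x + β l * expBaseDeriv l x) := funext hF
    rw [this]
    refine continuous_const.mul (continuous_finsetSum _ fun l _ => ?_)
    refine (continuous_const.mul ?_).add (continuous_const.mul ?_)
    · exact continuous_iff_continuousAt.mpr fun x => (hasDerivAt_expBase l x).continuousAt
    · exact continuous_iff_continuousAt.mpr fun x => (hasDerivAt_expBaseDeriv l x).continuousAt
  refine ⟨(1 + exp (-(μ : ℂ))) * c, mul_ne_zero ?_ hc, fun x => ?_⟩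
  · exact_mod_cast one_add_exp_int_ne_zero (-μ)
  · rw [hTsum, mul_assoc]
    refine periodStep_neg_one_eq μ hFcont (G := fun x => c * ∑ l ∈ S, T l x) (fun x => ?_) ?_ x
    · have h1 := (HasDerivAt.fun_sum (u := S) fun l _ => hTderiv l x).const_mul c
      refine h1.congr_deriv ?_
      rw [hF, Finset.sum_add_distrib, ← Finset.mul_sum]
      ring
    · rw [← mul_add, ← Finset.sum_add_distrib, Finset.sum_eq_zero fun l _ => hT01 l, mul_zero]

end Antiperiodic

/-! ### Nonvanishing at z = -1. -/

section NegOne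

theorem hasExpansion_nil {S : Finset ℤ} {M : ℤ} (hM : M ∈ S) :
    HasExpansion S (Pi.single M 1) 0 (period (-1) M []) := by
  have h1 := one_add_exp_int_ne_zero M
  refine ⟨exp (-(M : ℂ)) * (1 + exp (M : ℂ)), mul_ne_zero (exp_ne_zero _) h1, fun x => ?_⟩
  rw [Finset.sum_eq_single M]
  · simp only [period, Pi.single_eq_same, Pi.zero_apply, Rat.cast_one, Rat.cast_zero, one_mul,
      zero_mul, add_zero, expBase, ofReal_intCast]
    rw [mul_sub, mul_one, sub_eq_add_neg, exp_add]
    field_simp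
  · intro l _ hl
    simp [Pi.single_eq_of_ne hl]
  · exact fun h => absurd hM h

/-- The effect on the coefficients of the extreme nodes `m` and `M` of adding a list `l` of nodes
strictly between them, each at most twice. -/
theorem exists_hasExpansion_append {S : Finset ℤ} {m M : ℤ} (hS : ∀ l, m ≤ l → l ≤ M → l ∈ S)
    {α₀ β₀ : ℤ → ℚ} {L : List ℤ}
    (h₀ : HasExpansion S α₀ β₀ (period (-1) M (L.map (Int.cast : ℤ → ℝ))))
    (hz : ∀ l, l ≠ m → l ≠ M → α₀ l = 0 ∧ β₀ l = 0) (l : List ℤ)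
    (hl : ∀ μ ∈ l, m < μ ∧ μ < M) (hcount : ∀ μ, l.count μ ≤ 2) :
    ∃ α β : ℤ → ℚ, ∃ C > 0, ∃ C' > 0,
      HasExpansion S α β (period (-1) M ((l ++ L).map (Int.cast : ℤ → ℝ))) ∧
      (∀ μ ∉ l, μ ≠ m → μ ≠ M → α μ = 0 ∧ β μ = 0) ∧
      (∀ μ, l.count μ ≤ 1 → μ ≠ m → μ ≠ M → β μ = 0) ∧
      β M = C * β₀ M ∧ β m = (-1) ^ l.length * C' * β₀ m ∧
      (β₀ M = 0 → α M = C * α₀ M) ∧ (β₀ m = 0 → α m = (-1) ^ l.length * C' * α₀ m) := by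
  induction l with
  | nil =>
    exact ⟨α₀, β₀, 1, one_pos, 1, one_pos, by simpa using h₀, fun μ _ => hz μ,
      fun μ _ h h' => (hz μ h h').2, by simp, by simp, by simp, by simp⟩
  | cons μ l ih =>
    obtain ⟨α, β, C, hC, C', hC', hexp, hα, hβ, hβM, hβm, hαM, hαm⟩ := ih
      (fun ν hν => hl ν (List.mem_cons_of_mem _ hν))
      (fun ν => (List.count_le_count_cons).trans (hcount ν))
    obtain ⟨hμm, hμM⟩ := hl μ List.mem_cons_self
    have hμc : l.count μ ≤ 1 := by
      have := hcount μ
      rw [List.count_cons_self] at this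
      omega
    have hM0 : (0 : ℚ) < M - μ := sub_pos.mpr (by exact_mod_cast hμM)
    have hm0 : (0 : ℚ) < μ - m := sub_pos.mpr (by exact_mod_cast hμm)
    -- A new inner node divides the leading coefficient at M by M - μ > 0 and the one at m by m - μ
    -- < 0, hence the sign `(-1) ^ l.length`.
    have hm1 : (m : ℚ) - μ ≠ 0 := by linarith
    refine ⟨addNodeSimple S α β μ, addNodeDouble α β μ, C / (M - μ), div_pos hC hM0,
      C' / (μ - m), div_pos hC' hm0,
      hexp.periodStep (hS μ hμm.le hμM.le) (hβ μ hμc hμm.ne' hμM.ne), ?_, ?_, ?_, ?_, ?_, ?_⟩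
    · intro ν hν h1 h2
      rw [List.mem_cons, not_or] at hν
      obtain ⟨h3, h4⟩ := hα ν hν.2 h1 h2
      simp [addNodeSimple, addNodeDouble, Function.update_of_ne hν.1, addNodeAux, h3, h4]
    · intro ν hν h1 h2
      by_cases h3 : ν = μ
      · subst h3
        rw [List.count_cons_self] at hν
        have h4 : ν ∉ l := List.count_eq_zero.mp (by omega)
        simp [addNodeDouble, (hα ν h4 h1 h2).1]
      · simp [addNodeDouble, Function.update_of_ne h3,
          hβ ν ((List.count_le_count_cons).trans hν) h1 h2]
    · rw [addNodeDouble, Function.update_of_ne hμM.ne', hβM]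
      ring
    · rw [addNodeDouble, Function.update_of_ne hμm.ne, hβm, List.length_cons, pow_succ]
      field_simp
      ring
    · intro h
      rw [addNodeSimple, Function.update_of_ne hμM.ne', addNodeAux, hβM, h, hαM h]
      ring
    · intro h
      rw [addNodeSimple, Function.update_of_ne hμm.ne, addNodeAux, hβm, h, hαm h,
        List.length_cons, pow_succ]
      field_simp
      ring

theorem HasExpansion.apply_zero {S : Finset ℤ} {α β : ℤ → ℚ} {F : ℝ → ℂ}
    (h : HasExpansion S α β F) (h0 : F 0 = 0) :
    ∑ l ∈ S, ((α l : ℂ) * sigmoid l - β l * sigmoidDeriv l) = 0 := by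
  obtain ⟨c, hc, hF⟩ := h
  rw [hF, mul_eq_zero, or_iff_right hc] at h0
  simpa only [expBase_zero, expBaseDeriv_zero, mul_neg, ← sub_eq_add_neg] using h0

theorem addNodeAux_single {m M : ℤ} (l : ℤ) :
    addNodeAux (Pi.single M 1) 0 m l = (Pi.single M (1 / ((M : ℚ) - m)) : ℤ → ℚ) l := by
  by_cases hl : l = M
  · subst hl; simp [addNodeAux]
  · simp [addNodeAux, Pi.single_eq_of_ne hl]

/-- An exponential spline with simple extreme integer nodes `m < M` and an even number of inner
nodes of multiplicity at most two does not vanish at `z = -1`. -/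
theorem period_neg_one_simple_ne_zero {m M : ℤ} (hmM : m < M) (l : List ℤ)
    (hl : ∀ μ ∈ l, m < μ ∧ μ < M) (hcount : ∀ μ, l.count μ ≤ 2) (heven : Even l.length) :
    period (-1) M ((l ++ [m]).map (Int.cast : ℤ → ℝ)) 0 ≠ 0 := by
  intro h0
  -- Since m < M, this is the largest absolute value of a node, and it is positive.
  obtain ⟨L, hL⟩ : ∃ L : ℕ, (L : ℤ) = max M (-m) := ⟨(max M (-m)).toNat, by omega⟩
  have hL0 : L ≠ 0 := by omega
  set S := Finset.Icc (-(L : ℤ)) L with hSdef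
  have hS : ∀ l, m ≤ l → l ≤ M → l ∈ S := fun l h1 h2 => by
    rw [hSdef, Finset.mem_Icc]; omega
  have hpos : (0 : ℚ) < 1 / (M - m) := one_div_pos.mpr (sub_pos.mpr (by exact_mod_cast hmM))
  have hbase := (hasExpansion_nil (hS M hmM.le le_rfl)).periodStep (hS m le_rfl hmM.le) rfl
  have e1 : addNodeSimple S (Pi.single M 1) 0 m M = 1 / (M - m) := by
    rw [addNodeSimple, Function.update_of_ne hmM.ne', addNodeAux_single, Pi.single_eq_same]
  have e2 : addNodeSimple S (Pi.single M 1) 0 m m = -(1 / (M - m)) := by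
    rw [addNodeSimple, Function.update_self]
    simp only [addNodeAux_single]
    rw [Finset.sum_eq_single M, Pi.single_eq_same]
    · intro b _ hb; exact Pi.single_eq_of_ne hb _
    · exact fun h => absurd (hS M hmM.le le_rfl) h
  have e3 : ∀ μ, addNodeDouble (Pi.single M 1) 0 m μ = 0 := by
    intro μ
    by_cases h : μ = m
    · subst h; simp [addNodeDouble, hmM.ne]
    · simp [addNodeDouble, Function.update_of_ne h]
  have e4 : ∀ μ, μ ≠ m → μ ≠ M → addNodeSimple S (Pi.single M 1) 0 m μ = 0 := by
    intro μ h1 h2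
    rw [addNodeSimple, Function.update_of_ne h1, addNodeAux_single, Pi.single_eq_of_ne h2]
  obtain ⟨α, β, C, hC, C', hC', hexp, hz, -, hβM, hβm, hαM, hαm⟩ :=
    exists_hasExpansion_append hS (L := [m]) hbase (fun μ h1 h2 => ⟨e4 μ h1 h2, e3 μ⟩) l hl hcount
  have hsum := hexp.apply_zero h0
  rw [e3, mul_zero] at hβM hβm
  replace hαM : 0 < α M := by rw [hαM (e3 _), e1]; exact mul_pos hC hpos
  replace hαm : α m < 0 := by
    rw [hαm (e3 _), e2, heven.neg_one_pow, one_mul, mul_neg]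
    exact neg_neg_of_pos (mul_pos hC' hpos)
  have hout : ∀ μ, (μ < m ∨ M < μ) → α μ = 0 ∧ β μ = 0 := fun μ hμ =>
    hz μ (fun h => by have := hl μ h; omega) (by omega) (by omega)
  have hLM : (L : ℤ) = M ∨ M < L := by omega
  have hLm : -(L : ℤ) = m ∨ -(L : ℤ) < m := by omega
  have hβ1 : β L = 0 := by
    rcases hLM with h | h
    · rw [h, hβM]
    · exact (hout _ (Or.inr h)).2
  have hβ2 : β (-L) = 0 := by
    rcases hLm with h | h
    · rw [h, hβm]
    · exact (hout _ (Or.inl h)).2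
  -- The coefficients at ±L would be equal, but either they have opposite signs or exactly one is
  -- zero.
  have key := simple_coeff_eq hL0 α β hβ1 hβ2 hsum
  rcases hLM with h | h <;> rcases hLm with h' | h'
  · rw [h', h] at key; linarith
  · rw [(hout _ (Or.inl h')).1, h] at key; linarith
  · rw [h', (hout _ (Or.inr h)).1] at key; linarith
  · omega

/-- An exponential spline with double extreme integer nodes `m < M` and an even number of inner
nodes of multiplicity at most two does not vanish at `z = -1`. -/
theorem period_neg_one_double_ne_zero {m M : ℤ} (hmM : m < M) (l : List ℤ)
    (hl : ∀ μ ∈ l, m < μ ∧ μ < M) (hcount : ∀ μ, l.count μ ≤ 2) (heven : Even l.length) :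
    period (-1) M ((l ++ [m, m, M]).map (Int.cast : ℤ → ℝ)) 0 ≠ 0 := by
  intro h0
  obtain ⟨L, hL⟩ : ∃ L : ℕ, (L : ℤ) = max M (-m) := ⟨(max M (-m)).toNat, by omega⟩
  have hL0 : L ≠ 0 := by omega
  set S := Finset.Icc (-(L : ℤ)) L with hSdef
  have hS : ∀ l, m ≤ l → l ≤ M → l ∈ S := fun l h1 h2 => by
    rw [hSdef, Finset.mem_Icc]; omega
  have hMS := hS M hmM.le le_rfl
  have hmS := hS m le_rfl hmM.le
  have hpos : (0 : ℚ) < 1 / (M - m) ^ 2 :=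
    one_div_pos.mpr (pow_pos (sub_pos.mpr (by exact_mod_cast hmM)) 2)
  have e1 : addNodeSimple S (Pi.single M 1) 0 M = 0 := by
    have : ∀ l, addNodeAux (Pi.single M 1) 0 M l = 0 := fun l => by
      rw [addNodeAux_single, sub_self, div_zero, Pi.single_zero, Pi.zero_apply]
    funext l
    by_cases h : l = M
    · subst h; simp [addNodeSimple, this]
    · simp [addNodeSimple, Function.update_of_ne h, this]
  have e2 : addNodeDouble (Pi.single M 1) 0 M = Pi.single M 1 := by
    funext l
    by_cases h : l = M
    · subst h; simp [addNodeDouble]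
    · simp [addNodeDouble, Function.update_of_ne h, Pi.single_eq_of_ne h]
  -- Building the core M, M, m, m gives both double coefficients the same value 1/(M - m)^2.
  have h1 := (hasExpansion_nil hMS).periodStep hMS rfl
  rw [e1, e2] at h1
  have h2 := h1.periodStep hmS (Pi.single_eq_of_ne hmM.ne _)
  have h3 := h2.periodStep hmS (by simp [addNodeDouble])
  set α₂ := addNodeSimple S 0 (Pi.single M 1) m with hα₂
  set β₂ := addNodeDouble 0 (Pi.single M 1) m with hβ₂
  have e3 : ∀ l, addNodeAux 0 (Pi.single M 1) m l =
      (Pi.single M (-(1 / ((M : ℚ) - m) ^ 2)) : ℤ → ℚ) l := by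
    intro l
    by_cases hl : l = M
    · subst hl; simp [addNodeAux]
    · simp [addNodeAux, Pi.single_eq_of_ne hl]
  have e4 : α₂ m = 1 / (M - m) ^ 2 := by
    rw [hα₂, addNodeSimple, Function.update_self]
    simp only [e3]
    rw [Finset.sum_eq_single M, Pi.single_eq_same, neg_neg]
    · intro b _ hb; exact Pi.single_eq_of_ne hb _
    · exact fun h => absurd hMS h
  have e5 : addNodeDouble α₂ β₂ m m = 1 / (M - m) ^ 2 := by
    rw [addNodeDouble, Function.update_self, e4]
  have e6 : addNodeDouble α₂ β₂ m M = 1 / (M - m) ^ 2 := by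
    rw [addNodeDouble, Function.update_of_ne hmM.ne', hβ₂, addNodeDouble,
      Function.update_of_ne hmM.ne', Pi.single_eq_same, div_div, sq]
  have e7 : ∀ μ, μ ≠ m → μ ≠ M →
      addNodeSimple S α₂ β₂ m μ = 0 ∧ addNodeDouble α₂ β₂ m μ = 0 := by
    intro μ h1 h2
    have h4 : α₂ μ = 0 := by
      rw [hα₂, addNodeSimple, Function.update_of_ne h1, e3, Pi.single_eq_of_ne h2]
    have h5 : β₂ μ = 0 := by
      simp [hβ₂, addNodeDouble, Function.update_of_ne h1, Pi.single_eq_of_ne h2]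
    simp [addNodeSimple, addNodeDouble, Function.update_of_ne h1, addNodeAux, h4, h5]
  obtain ⟨α, β, C, hC, C', hC', hexp, hz, -, hβM, hβm, -, -⟩ :=
    exists_hasExpansion_append hS (L := [m, m, M]) h3 e7 l hl hcount
  have hsum := hexp.apply_zero h0
  rw [e6] at hβM
  rw [e5, heven.neg_one_pow, one_mul] at hβm
  have hβM' : 0 < β M := by rw [hβM]; exact mul_pos hC hpos
  have hβm' : 0 < β m := by rw [hβm]; exact mul_pos hC' hpos
  have hout : ∀ μ, (μ < m ∨ M < μ) → β μ = 0 := fun μ hμ =>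
    (hz μ (fun h => by have := hl μ h; omega) (by omega) (by omega)).2
  have hLM : (L : ℤ) = M ∨ M < L := by omega
  have hLm : -(L : ℤ) = m ∨ -(L : ℤ) < m := by omega
  -- The sum over ±L is positive: each term is positive or zero, and they are not both zero.
  have key := double_coeff_add_eq_zero hL0 α β hsum
  rcases hLM with h | h <;> rcases hLm with h' | h'
  · rw [h', h] at key; linarith
  · rw [hout _ (Or.inl h'), h] at key; linarith
  · rw [h', hout _ (Or.inr h)] at key; linarith
  · omega

end NegOne

theorem continuous_periodStep (z : ℂ) (l : ℝ) {F : ℝ → ℂ} (hF : Continuous F) :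
    Continuous (periodStep z l F) := by
  have hc : Continuous fun u : ℝ => exp (-(l * u : ℂ)) * F u := by fun_prop
  have h1 : Continuous fun x => ∫ u in (0 : ℝ)..x, exp (-(l * u : ℂ)) * F u :=
    intervalIntegral.continuous_primitive (fun a b => hc.intervalIntegrable a b) 0
  have h2 : Continuous fun x => ∫ u in x..(1 : ℝ), exp (-(l * u : ℂ)) * F u := by
    simp only [intervalIntegral.integral_symm (1 : ℝ)]
    exact (intervalIntegral.continuous_primitive (fun a b => hc.intervalIntegrable a b) 1).neg
  unfold periodStep
  fun_prop

theorem continuous_period (z : ℂ) (l₀ : ℝ) (L : List ℝ) : Continuous (period z l₀ L) := by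
  induction L with
  | nil => unfold period; fun_prop
  | cons l L ih => exact continuous_periodStep z l ih

/-! ### Nonreal z: control of the argument. -/

section HalfPlane

/-- The cross product of two complex numbers. -/
def cross (p q : ℂ) : ℝ := p.re * q.im - p.im * q.re

theorem cross_eq_im (p q : ℂ) : cross p q = (starRingEnd ℂ p * q).im := by
  simp [cross]; ring

theorem cross_smul_smul (r s : ℝ) (p q : ℂ) : cross (r * p) (s * q) = r * s * cross p q := by
  simp [cross]; ring

theorem cross_integral_right (p : ℂ) {F : ℝ → ℂ} (hF : Continuous F) (a b : ℝ) :
    cross p (∫ u in a..b, F u) = ∫ u in a..b, cross p (F u) := by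
  simp only [cross_eq_im, ← intervalIntegral.integral_const_mul]
  have h : Continuous fun u => starRingEnd ℂ p * F u := by fun_prop
  exact (imCLM.intervalIntegral_comp_comm (h.intervalIntegrable a b)).symm

theorem cross_swap (p q : ℂ) : cross p q = cross (-q) p := by
  simp [cross]; ring

theorem cross_integral_nonneg {F G : ℝ → ℂ} (hF : Continuous F) (hG : Continuous G) {a b c d : ℝ}
    (hab : a ≤ b) (hcd : c ≤ d)
    (h : ∀ u ∈ Set.Icc a b, ∀ v ∈ Set.Icc c d, 0 ≤ cross (F u) (G v)) :
    0 ≤ cross (∫ u in a..b, F u) (∫ v in c..d, G v) := by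
  rw [cross_integral_right _ hG]
  refine intervalIntegral.integral_nonneg hcd fun v hv => ?_
  rw [cross_swap, cross_integral_right _ hF]
  refine intervalIntegral.integral_nonneg hab fun u hu => ?_
  rw [← cross_swap]
  exact h u hu v hv

/-- Along `[0, 1]` the argument of `F` decreases, by at most the argument of `z`. -/
structure TurnsWithin (z : ℂ) (F : ℝ → ℂ) : Prop where
  ne_zero : F 0 ≠ 0
  clockwise : ∀ u v, 0 ≤ u → u ≤ v → v ≤ 1 → 0 ≤ cross (F v) (F u)
  bounded : ∀ u v, 0 ≤ u → u ≤ v → v ≤ 1 → 0 ≤ cross (F u) (z * F v)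

theorem TurnsWithin.smul {z : ℂ} {F : ℝ → ℂ} (h : TurnsWithin z F) (r : ℝ → ℝ)
    (hr : ∀ u, 0 < r u) : TurnsWithin z fun u => r u * F u where
  ne_zero := mul_ne_zero (ofReal_ne_zero.mpr (hr 0).ne') h.ne_zero
  clockwise u v h0 huv h1 := by
    rw [cross_smul_smul]
    exact mul_nonneg (mul_pos (hr v) (hr u)).le (h.clockwise u v h0 huv h1)
  bounded u v h0 huv h1 := by
    rw [mul_left_comm, cross_smul_smul]
    exact mul_nonneg (mul_pos (hr u) (hr v)).le (h.bounded u v h0 huv h1)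

/-- A, B, D stand for the integrals over [0, x], [x, y], [y, 1]. For a > 0 and Im z > 0 every term
on the right is nonnegative by the turning property of the integrand. -/
theorem cross_combination_eq (a : ℝ) (z A B D : ℂ) :
    cross (a * (A + B) + z * D) (a * A + z * (B + D)) =
      a * cross A (z * B) + a ^ 2 * cross B A + a * z.im * normSq B + a * cross B (z * D) +
        normSq z * cross D B := by
  simp [cross, normSq_apply]; ring

theorem cross_mul_combination_eq (a : ℝ) (z A B D : ℂ) :
    cross (a * A + z * (B + D)) (z * (a * (A + B) + z * D)) =
      z.im * normSq (a * A + z * D) + a ^ 2 * cross A (z * B) + a * normSq z * cross B A +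
        normSq z * cross B (z * D) + a * normSq z * cross D B := by
  simp [cross, normSq_apply]; ring

theorem TurnsWithin.average {z : ℂ} {F : ℝ → ℂ} (h : TurnsWithin z F) (hF : Continuous F)
    (hz : 0 < z.im) {a : ℝ} (ha : 0 < a) :
    TurnsWithin z fun x => a * (∫ u in (0 : ℝ)..x, F u) + z * ∫ u in x..1, F u := by
  have hz0 : z ≠ 0 := fun h => by simp [h] at hz
  have hzF : Continuous fun u => z * F u := by fun_prop
  have split : ∀ p q r : ℝ, ∫ u in p..r, F u = (∫ u in p..q, F u) + ∫ u in q..r, F u :=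
    fun p q r => (intervalIntegral.integral_add_adjacent_intervals
      (hF.intervalIntegrable _ _) (hF.intervalIntegrable _ _)).symm
  have cw : ∀ p q r : ℝ, 0 ≤ p → p ≤ q → q ≤ r → r ≤ 1 →
      0 ≤ cross (∫ u in q..r, F u) (∫ u in p..q, F u) := fun p q r h0 h1 h2 h3 =>
    cross_integral_nonneg hF hF h2 h1 fun u hu v hv =>
      h.clockwise v u (h0.trans hv.1) (hv.2.trans hu.1) (hu.2.trans h3)
  have bd : ∀ p q r : ℝ, 0 ≤ p → p ≤ q → q ≤ r → r ≤ 1 →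
      0 ≤ cross (∫ u in p..q, F u) (z * ∫ u in q..r, F u) := fun p q r h0 h1 h2 h3 => by
    rw [← intervalIntegral.integral_const_mul]
    exact cross_integral_nonneg hF hzF h1 h2 fun u hu v hv =>
      h.bounded u v (h0.trans hu.1) (hu.2.trans hv.1) (hv.2.trans h3)
  constructor
  · simp only [intervalIntegral.integral_same, mul_zero, zero_add]
    refine mul_ne_zero hz0 fun h0 => ?_
    -- The integrand `cross (F 0) (z * F u)` is nonnegative, and at u = 0 it equals Im z · |F(0)|² >
    -- 0, so its integral cannot vanish.
    have h1 : cross (F 0) (∫ u in (0 : ℝ)..1, z * F u) = 0 := by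
      rw [intervalIntegral.integral_const_mul, h0]; simp [cross]
    rw [cross_integral_right _ hzF] at h1
    refine h1.not_gt (intervalIntegral.integral_pos one_pos ?_ ?_ ⟨0, by simp, ?_⟩)
    · unfold cross; fun_prop
    · exact fun u hu => h.bounded 0 u le_rfl hu.1.le hu.2
    · have : cross (F 0) (z * F 0) = z.im * normSq (F 0) := by
        simp [cross, normSq_apply]; ring
      rw [this]
      exact mul_pos hz (normSq_pos.mpr h.ne_zero)
  · intro x y h0 hxy h1
    rw [split 0 x y, split x y 1, cross_combination_eq]
    have t1 := bd 0 x y le_rfl h0 hxy h1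
    have t2 := cw 0 x y le_rfl h0 hxy h1
    have t3 := bd x y 1 h0 hxy h1 le_rfl
    have t4 := cw x y 1 h0 hxy h1 le_rfl
    have := normSq_nonneg (∫ u in x..y, F u)
    have := normSq_nonneg z
    positivity
  · intro x y h0 hxy h1
    rw [split 0 x y, split x y 1, cross_mul_combination_eq]
    have t1 := bd 0 x y le_rfl h0 hxy h1
    have t2 := cw 0 x y le_rfl h0 hxy h1
    have t3 := bd x y 1 h0 hxy h1 le_rfl
    have t4 := cw x y 1 h0 hxy h1 le_rfl
    have := normSq_nonneg (a * (∫ u in (0 : ℝ)..x, F u) + z * ∫ u in y..1, F u)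
    have := normSq_nonneg z
    positivity

/-- Isolates the positive real factors, which do not affect arguments or signs. -/
theorem periodStep_eq (z : ℂ) (l : ℝ) (F : ℝ → ℂ) (x : ℝ) :
    periodStep z l F x = Real.exp (l * x) * (Real.exp (-l) *
      (∫ u in (0 : ℝ)..x, (Real.exp (-(l * u)) : ℂ) * F u) +
        z * ∫ u in x..1, (Real.exp (-(l * u)) : ℂ) * F u) := by
  rw [periodStep]
  push_cast
  rw [mul_sub, mul_one, sub_eq_add_neg, exp_add]
  ring

theorem turnsWithin_period {z : ℂ} (hz : 0 < z.im) (l₀ : ℝ) (L : List ℝ) :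
    TurnsWithin z (period z l₀ L) := by
  induction L with
  | nil =>
    have h1 : TurnsWithin z fun _ => 1 :=
      ⟨one_ne_zero, by simp [cross], by simp [cross, hz.le]⟩
    have h2 := h1.smul (fun u => Real.exp (l₀ * (u - 1))) fun u => Real.exp_pos _
    convert h2 using 2 with u
    simp [period]
  | cons l L ih =>
    have h1 := ih.smul (fun u => Real.exp (-(l * u))) fun u => Real.exp_pos _
    have hc := continuous_period z l₀ L
    have h2 := (h1.average (by fun_prop) hz (Real.exp_pos (-l))).smul (fun x => Real.exp (l * x))
      fun u => Real.exp_pos _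
    convert h2 using 2 with x
    exact periodStep_eq z l _ x

theorem period_conj (z : ℂ) (l₀ : ℝ) (L : List ℝ) (x : ℝ) :
    period (starRingEnd ℂ z) l₀ L x = starRingEnd ℂ (period z l₀ L x) := by
  induction L generalizing x with
  | nil => simp [period, ← exp_conj]
  | cons l L ih =>
    have hint : ∀ a b : ℝ,
        ∫ u in a..b, (Real.exp (-(l * u)) : ℂ) * period (starRingEnd ℂ z) l₀ L u =
        starRingEnd ℂ (∫ u in a..b, (Real.exp (-(l * u)) : ℂ) * period z l₀ L u) := by
      intro a b
      simp only [intervalIntegral, map_sub, ← integral_conj, map_mul, conj_ofReal, ih]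
    simp only [period]
    rw [periodStep_eq, periodStep_eq, hint, hint]
    simp only [map_mul, map_add, conj_ofReal]

theorem period_ne_zero_of_im_ne_zero {z : ℂ} (hz : z.im ≠ 0) (l₀ : ℝ) (L : List ℝ) :
    period z l₀ L 0 ≠ 0 := by
  rcases hz.lt_or_gt with h | h
  · have h1 := (turnsWithin_period (z := starRingEnd ℂ z) (by simpa using h) l₀ L).ne_zero
    rw [period_conj] at h1
    exact fun h0 => h1 (by rw [h0, map_zero])
  · exact (turnsWithin_period h l₀ L).ne_zero

end HalfPlane

/-! ### Positivity: z = 1, and splines with two nodes. -/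

theorem re_period_one_pos (l₀ : ℝ) (L : List ℝ) {x : ℝ} (hx : x ∈ Set.Icc (0 : ℝ) 1) :
    0 < (period 1 l₀ L x).re := by
  induction L generalizing x with
  | nil =>
    have : period 1 l₀ [] x = (Real.exp (l₀ * (x - 1)) : ℂ) := by simp [period]
    rw [this, ofReal_re]
    exact Real.exp_pos _
  | cons l L ih =>
    have hc := continuous_period 1 l₀ L
    set g : ℝ → ℝ := fun u => Real.exp (-(l * u)) * (period 1 l₀ L u).re with hg
    have hgc : Continuous g := by fun_prop
    have hgpos : ∀ u ∈ Set.Icc (0 : ℝ) 1, 0 < g u := fun u hu => mul_pos (Real.exp_pos _) (ih hu)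
    have hint : ∀ a b : ℝ, (∫ u in a..b, (Real.exp (-(l * u)) : ℂ) * period 1 l₀ L u).re =
        ∫ u in a..b, g u := by
      intro a b
      have h : Continuous fun u => (Real.exp (-(l * u)) : ℂ) * period 1 l₀ L u := by fun_prop
      exact (reCLM.intervalIntegral_comp_comm
        (h.intervalIntegrable (μ := MeasureTheory.volume) a b)).symm.trans
        (intervalIntegral.integral_congr fun u _ => re_ofReal_mul _ _)
    have h0 : 0 ≤ ∫ u in (0 : ℝ)..x, g u := intervalIntegral.integral_nonneg hx.1 fun u hu =>
      (hgpos u ⟨hu.1, hu.2.trans hx.2⟩).le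
    have h1 : 0 ≤ ∫ u in x..1, g u := intervalIntegral.integral_nonneg hx.2 fun u hu =>
      (hgpos u ⟨hx.1.trans hu.1, hu.2⟩).le
    have h01 : 0 < (∫ u in (0 : ℝ)..x, g u) + ∫ u in x..1, g u := by
      rw [intervalIntegral.integral_add_adjacent_intervals (hgc.intervalIntegrable _ _)
        (hgc.intervalIntegrable _ _)]
      exact intervalIntegral.intervalIntegral_pos_of_pos_on (hgc.intervalIntegrable _ _)
        (fun u hu => hgpos u ⟨hu.1.le, hu.2.le⟩) one_pos
    simp only [period]
    rw [periodStep_eq, re_ofReal_mul, one_mul, add_re, re_ofReal_mul, hint, hint]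
    refine mul_pos (Real.exp_pos _) ?_
    rcases h0.eq_or_lt with h2 | h2
    · rw [← h2] at h01 ⊢
      linarith
    · have := mul_pos (Real.exp_pos (-l)) h2
      linarith

theorem period_pair_ne_zero {z : ℂ} (hz : z ≠ 0) (l₀ l : ℝ) : period z l₀ [l] 0 ≠ 0 := by
  simp only [period]
  rw [periodStep_eq]
  have h : ∫ u in (0 : ℝ)..1, (Real.exp (-(l * u)) : ℂ) * exp (l₀ * (u - 1)) =
      ((∫ u in (0 : ℝ)..1, Real.exp (-(l * u)) * Real.exp (l₀ * (u - 1)) : ℝ) : ℂ) := by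
    rw [← intervalIntegral.integral_ofReal]
    push_cast
    rfl
  have hpos : 0 < ∫ u in (0 : ℝ)..1, Real.exp (-(l * u)) * Real.exp (l₀ * (u - 1)) :=
    intervalIntegral.intervalIntegral_pos_of_pos
      (Continuous.intervalIntegrable (by fun_prop) _ _) (fun u => by positivity) one_pos
  rw [h]
  simpa [hz] using hpos.ne'

open MeasureTheory

/-! ### Splines as iterated convolutions, and their periods. -/

section TimeDomain

/-- The TB-spline `e ^ (l (t - 1))` on `[0, 1)` of order one. -/
noncomputable def kernel (l : ℝ) : ℝ → ℂ :=
  (Set.Ico (0 : ℝ) 1).indicator fun t => exp (l * (t - 1))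

/-- The TB-spline of `l₀ :: L` as an iterated convolution of splines of order one. -/
noncomputable def spline (l₀ : ℝ) : List ℝ → ℝ → ℂ
  | [] => kernel l₀
  | l :: L => fun t => exp (l * (t - 1)) * ∫ u in (t - 1)..t, exp (-(l * u)) * spline l₀ L u

theorem spline_cons (l₀ l : ℝ) (L : List ℝ) (t : ℝ) : spline l₀ (l :: L) t =
    exp (l * (t - 1)) * ∫ u in (t - 1)..t, exp (-(l * u)) * spline l₀ L u := rfl

theorem integrable_kernel (l : ℝ) : Integrable (kernel l) := by
  rw [kernel, integrable_indicator_iff measurableSet_Ico]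
  exact (Continuous.continuousOn (by fun_prop)).integrableOn_Icc.mono_set Set.Ico_subset_Icc_self

open Convolution in
theorem spline_cons_eq_convolution (l₀ l : ℝ) (L : List ℝ) :
    spline l₀ (l :: L) = kernel l ⋆[ContinuousLinearMap.mul ℂ ℂ] spline l₀ L := by
  ext t
  rw [convolution_eq_swap, spline_cons, intervalIntegral.integral_of_le (by linarith),
    ← integral_const_mul, ← integral_indicator measurableSet_Ioc]
  congr 1
  ext u
  rw [ContinuousLinearMap.mul_apply', kernel]
  by_cases hu : u ∈ Set.Ioc (t - 1) t
  · rw [Set.indicator_of_mem hu, Set.indicator_of_mem, ← mul_assoc, ← exp_add]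
    · congr 2
      push_cast
      ring
    · exact ⟨by linarith [hu.2], by linarith [hu.1]⟩
  · rw [Set.indicator_of_notMem hu, Set.indicator_of_notMem, zero_mul]
    exact fun h => hu ⟨by linarith [h.2], by linarith [h.1]⟩

theorem integrable_spline (l₀ : ℝ) (L : List ℝ) : Integrable (spline l₀ L) := by
  induction L with
  | nil => exact integrable_kernel l₀
  | cons l L ih =>
    rw [spline_cons_eq_convolution]
    exact (integrable_kernel l).integrable_convolution _ ih

theorem intervalIntegrable_exp_mul_spline (c : ℝ) (l₀ : ℝ) (L : List ℝ) (s a b : ℝ) :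
    IntervalIntegrable (fun u : ℝ => exp (-(c * u)) * spline l₀ L (u + s)) volume a b :=
  ((integrable_spline l₀ L).comp_add_right s).intervalIntegrable.continuousOn_mul
    (Continuous.continuousOn (by fun_prop))

theorem continuous_spline_cons (l₀ l : ℝ) (L : List ℝ) : Continuous (spline l₀ (l :: L)) := by
  have hi : ∀ a b, IntervalIntegrable (fun u : ℝ => exp (-(l * u)) * spline l₀ L u) volume a b := by
    simpa using intervalIntegrable_exp_mul_spline l l₀ L 0
  have h1 := intervalIntegral.continuous_primitive hi 0
  have h2 : spline l₀ (l :: L) = fun t : ℝ => exp (l * (t - 1)) *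
      ((∫ u in (0 : ℝ)..t, exp (-(l * u)) * spline l₀ L u) -
        ∫ u in (0 : ℝ)..(t - 1), exp (-(l * u)) * spline l₀ L u) := by
    ext t
    rw [spline_cons, intervalIntegral.integral_interval_sub_left (hi _ _) (hi _ _)]
  rw [h2]
  have h3 := h1.comp (continuous_id.sub (continuous_const (y := (1 : ℝ))))
  exact Continuous.mul (by fun_prop) (h1.sub h3)

theorem spline_eq_zero (l₀ : ℝ) (L : List ℝ) {t : ℝ} (ht : t < 0 ∨ (L.length + 1 : ℝ) ≤ t) :
    spline l₀ L t = 0 := by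
  induction L generalizing t with
  | nil =>
    rw [spline, kernel]
    refine Set.indicator_of_notMem (fun h => ?_) _
    rcases ht with h' | h'
    · exact h'.not_ge h.1
    · simp only [List.length_nil, Nat.cast_zero, zero_add] at h'
      exact h'.not_gt h.2
  | cons l L ih =>
    simp only [List.length_cons, Nat.cast_add, Nat.cast_one] at ht
    rw [spline_cons, intervalIntegral.integral_congr_Ioo_of_le (g := 0) (by linarith)]
    · simp
    · intro u hu
      simp only [Pi.zero_apply]
      rw [ih, mul_zero]
      rcases ht with h | h
      · exact Or.inl (hu.2.trans h)
      · exact Or.inr (by linarith [hu.1])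

/-- The window [x + j - 1, x + j] is cut at the integer j. Its two pieces give the two terms of
`periodStep`, and the shift j - 1 in the second supplies the factor z. -/
theorem spline_cons_add (l₀ l : ℝ) (L : List ℝ) (x : ℝ) (j : ℤ) :
    spline l₀ (l :: L) (x + j) =
      exp (l * (x - 1)) * (∫ u in (0 : ℝ)..x, exp (-(l * u)) * spline l₀ L (u + j)) +
      exp (l * x) * ∫ u in x..1, exp (-(l * u)) * spline l₀ L (u + (j - 1 : ℤ)) := by
  have hi : ∀ a b, IntervalIntegrable (fun u : ℝ => exp (-(l * u)) * spline l₀ L u) volume a b := by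
    simpa using intervalIntegrable_exp_mul_spline l l₀ L 0
  have shift : ∀ (a b : ℝ) (i : ℤ), ∫ u in (a + i)..(b + i), exp (-(l * u)) * spline l₀ L u =
      exp (-(l * i)) * ∫ u in a..b, exp (-(l * u)) * spline l₀ L (u + i) := by
    intro a b i
    rw [← intervalIntegral.integral_comp_add_right, ← intervalIntegral.integral_const_mul]
    refine intervalIntegral.integral_congr fun u _ => ?_
    rw [← mul_assoc, ← exp_add]
    congr 2
    push_cast
    ring
  have e1 : x + (j : ℝ) - 1 = x + (j - 1 : ℤ) := by push_cast; ring
  have e2 : (1 : ℝ) + (j - 1 : ℤ) = 0 + (j : ℤ) := by push_cast; ring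
  rw [spline_cons, ← intervalIntegral.integral_add_adjacent_intervals (hi _ (0 + j)) (hi _ _), shift,
    e1, ← e2, shift, mul_add, add_comm, ← mul_assoc, ← mul_assoc, ← exp_add, ← exp_add]
  congr 3 <;> push_cast <;> ring

/-- The hypothesis is confined to the open interval because the order-one spline jumps at 0 and 1;
integration recovers the endpoints. -/
theorem sum_spline_cons (z : ℂ) (l₀ l : ℝ) (L : List ℝ)
    (h : ∀ x ∈ Set.Ioo (0 : ℝ) 1,
      ∑ j ∈ Finset.range (L.length + 1), z ^ j * spline l₀ L (x + (j : ℤ)) = period z l₀ L x)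
    {x : ℝ} (hx : x ∈ Set.Icc (0 : ℝ) 1) :
    ∑ j ∈ Finset.range (L.length + 2), z ^ j * spline l₀ (l :: L) (x + (j : ℤ)) =
      period z l₀ (l :: L) x := by
  have hint : ∀ a b : ℝ, 0 ≤ a → a ≤ b → b ≤ 1 →
      ∑ j ∈ Finset.range (L.length + 1),
        z ^ j * ∫ u in a..b, exp (-(l * u)) * spline l₀ L (u + (j : ℤ)) =
      ∫ u in a..b, exp (-(l * u)) * period z l₀ L u := by
    intro a b ha hab hb
    simp only [← intervalIntegral.integral_const_mul]
    rw [← intervalIntegral.integral_finsetSum fun j _ =>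
      (intervalIntegrable_exp_mul_spline l l₀ L _ a b).const_mul _]
    refine intervalIntegral.integral_congr_Ioo_of_le hab fun u hu => ?_
    rw [← h u ⟨ha.trans_lt hu.1, hu.2.trans_le hb⟩, Finset.mul_sum]
    exact Finset.sum_congr rfl fun j _ => by ring
  have hlast : ∫ u in (0 : ℝ)..x, exp (-(l * u)) *
      spline l₀ L (u + ((L.length + 1 : ℕ) : ℤ)) = 0 := by
    rw [intervalIntegral.integral_congr_Ioo_of_le (g := 0) hx.1]
    · simp
    · intro u hu
      simp only [Pi.zero_apply]
      rw [spline_eq_zero, mul_zero]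
      right
      push_cast
      linarith [hu.1]
  have hfirst : ∫ u in x..1, exp (-(l * u)) * spline l₀ L (u + ((0 : ℕ) - 1 : ℤ)) = 0 := by
    rw [intervalIntegral.integral_congr_Ioo_of_le (g := 0) hx.2]
    · simp
    · intro u hu
      simp only [Pi.zero_apply]
      rw [spline_eq_zero, mul_zero]
      left
      push_cast
      linarith [hu.2]
  simp only [spline_cons_add, mul_add, Finset.sum_add_distrib, period, periodStep]
  rw [← hint 0 x le_rfl hx.1 hx.2, ← hint x 1 hx.1 hx.2 le_rfl, Finset.sum_range_succ, hlast,
    Finset.sum_range_succ' (n := L.length + 1), hfirst]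
  simp only [mul_zero, add_zero, Finset.mul_sum]
  congr 1
  · exact Finset.sum_congr rfl fun j _ => by ring
  · refine Finset.sum_congr rfl fun j _ => ?_
    have : ((j + 1 : ℕ) : ℤ) - 1 = j := by push_cast; ring
    rw [this, pow_succ]
    ring

theorem sum_spline_eq_period (z : ℂ) (l₀ : ℝ) (L : List ℝ) :
    ∀ x ∈ Set.Ioo (0 : ℝ) 1,
      ∑ j ∈ Finset.range (L.length + 1), z ^ j * spline l₀ L (x + (j : ℤ)) = period z l₀ L x := by
  induction L with
  | nil =>
    intro x hx
    simp [spline, kernel, period, Set.indicator_of_mem (Set.Ioo_subset_Ico_self hx)]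
  | cons l L ih => exact fun x hx => sum_spline_cons z l₀ l L ih (Set.Ioo_subset_Icc_self hx)

theorem tsum_spline_neg (z : ℂ) (l₀ l : ℝ) (L : List ℝ) :
    ∑' j : ℤ, z ^ j * spline l₀ (l :: L) (-(j : ℝ)) = period z⁻¹ l₀ (l :: L) 0 := by
  have h := sum_spline_cons z⁻¹ l₀ l L (sum_spline_eq_period z⁻¹ l₀ L) (x := 0) (by simp)
  rw [← h, ← (Equiv.neg ℤ).tsum_eq]
  rw [tsum_eq_sum (s := (Finset.range (L.length + 2)).map Nat.castEmbedding)]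
  · rw [Finset.sum_map]
    refine Finset.sum_congr rfl fun j _ => ?_
    simp
  · intro j hj
    simp only [Equiv.neg_apply]
    rw [spline_eq_zero, mul_zero]
    by_contra! hcon
    push_cast [List.length_cons] at hcon
    rw [neg_neg] at hcon
    have h1 : 0 ≤ j := by exact_mod_cast hcon.1
    have h2 : j < L.length + 1 + 1 := by exact_mod_cast hcon.2
    refine hj (Finset.mem_map.mpr ⟨j.toNat, Finset.mem_range.mpr (by omega), ?_⟩)
    simp [h1]

end TimeDomain

/-! ### Identification with the Fourier definition. -/

section Fourier

open FourierTransform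

theorem I_mul_sub_ne_zero (l : ℝ) {ξ : ℝ} (hξ : ξ ≠ 0) : I * (ξ : ℂ) - l ≠ 0 := fun h => hξ <| by
  simpa using congrArg im h

theorem fourier_kernel (l : ℝ) {ξ : ℝ} (hξ : ξ ≠ 0) :
    𝓕 (kernel l) ξ = (exp (-(l : ℂ)) - exp (-(I * ((2 * Real.pi * ξ : ℝ) : ℂ)))) /
      (I * ((2 * Real.pi * ξ : ℝ) : ℂ) - l) := by
  have hd : I * ((2 * Real.pi * ξ : ℝ) : ℂ) - l ≠ 0 :=
    I_mul_sub_ne_zero l (mul_ne_zero (by positivity) hξ)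
  have hc : (l : ℂ) - I * ((2 * Real.pi * ξ : ℝ) : ℂ) ≠ 0 := fun h => hd <| by
    rw [← neg_sub, h, neg_zero]
  rw [Real.fourier_real_eq_integral_exp_smul]
  have h1 : ∀ v : ℝ, exp (↑(-2 * Real.pi * v * ξ) * I) • kernel l v =
      (Set.Ico (0 : ℝ) 1).indicator (fun v : ℝ => exp (-(l : ℂ)) *
        exp (((l : ℂ) - I * ((2 * Real.pi * ξ : ℝ) : ℂ)) * v)) v := by
    intro v
    by_cases hv : v ∈ Set.Ico (0 : ℝ) 1
    · rw [kernel, Set.indicator_of_mem hv, Set.indicator_of_mem hv, smul_eq_mul, ← exp_add,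
        ← exp_add]
      congr 1
      push_cast
      ring
    · rw [kernel, Set.indicator_of_notMem hv, Set.indicator_of_notMem hv, smul_zero]
  simp only [h1]
  rw [integral_indicator measurableSet_Ico, integral_Ico_eq_integral_Ioc,
    ← intervalIntegral.integral_of_le zero_le_one, intervalIntegral.integral_const_mul,
    integral_exp_mul_complex hc, ofReal_one, ofReal_zero, mul_one, mul_zero, exp_zero, sub_eq_add_neg
    (l : ℂ), exp_add, exp_neg (l : ℂ)]
  rw [← sub_eq_add_neg]
  have := exp_ne_zero (l : ℂ)
  field_simp
  ring

theorem fourier_spline_cons (l₀ l : ℝ) (L : List ℝ) (ξ : ℝ) :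
    𝓕 (spline l₀ (l :: L)) ξ = 𝓕 (kernel l) ξ * 𝓕 (spline l₀ L) ξ := by
  rw [spline_cons_eq_convolution]
  exact Real.fourier_mul_convolution_eq (integrable_kernel l) (integrable_spline l₀ L) ξ

theorem fourier_spline (l₀ : ℝ) (L : List ℝ) {ξ : ℝ} (hξ : ξ ≠ 0) :
    𝓕 (spline l₀ L) ξ = tbSplineHat (l₀ :: L : List ℝ) (2 * Real.pi * ξ) := by
  induction L with
  | nil => simpa [tbSplineHat, spline] using fourier_kernel l₀ hξ
  | cons l L ih =>
    rw [fourier_spline_cons, ih, fourier_kernel l hξ]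
    simp only [tbSplineHat, Multiset.map_coe, Multiset.prod_coe, List.map_cons, List.prod_cons]
    ring

theorem norm_fourier_kernel_mul_le (l ξ : ℝ) :
    ‖𝓕 (kernel l) ξ‖ * (1 + |ξ|) ≤ (∫ v, ‖kernel l v‖) + (Real.exp (-l) + 1) := by
  have h1 : ‖𝓕 (kernel l) ξ‖ ≤ ∫ v, ‖kernel l v‖ :=
    VectorFourier.norm_fourierIntegral_le_integral_norm _ _ _ _ _
  rw [mul_add, mul_one]
  refine add_le_add h1 ?_
  by_cases hξ : ξ = 0
  · rw [hξ, abs_zero, mul_zero]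
    positivity
  · rw [fourier_kernel l hξ, norm_div, div_mul_eq_mul_div]
    have hden : |ξ| ≤ ‖I * ((2 * Real.pi * ξ : ℝ) : ℂ) - l‖ := by
      refine le_trans ?_ (abs_im_le_norm _)
      have : (I * ((2 * Real.pi * ξ : ℝ) : ℂ) - l).im = 2 * Real.pi * ξ := by simp
      rw [this, abs_mul, abs_of_pos Real.two_pi_pos]
      exact le_mul_of_one_le_left (abs_nonneg _) (by linarith [Real.pi_gt_three])
    have hnum : ‖exp (-(l : ℂ)) - exp (-(I * ((2 * Real.pi * ξ : ℝ) : ℂ)))‖ ≤ Real.exp (-l) + 1 := by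
      refine (norm_sub_le _ _).trans (le_of_eq ?_)
      rw [norm_exp, norm_exp]
      simp
    have hpos : 0 < |ξ| := abs_pos.mpr hξ
    rw [div_le_iff₀ (hpos.trans_le hden)]
    exact mul_le_mul hnum hden hpos.le (by positivity)

theorem exists_norm_fourier_spline_mul_le (l₀ : ℝ) (L : List ℝ) :
    ∃ C, ∀ ξ, ‖𝓕 (spline l₀ L) ξ‖ * (1 + |ξ|) ≤ C := by
  induction L with
  | nil => exact ⟨_, norm_fourier_kernel_mul_le l₀⟩
  | cons l L ih =>
    obtain ⟨C, hC⟩ := ih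
    refine ⟨(∫ v, ‖kernel l v‖) * C, fun ξ => ?_⟩
    rw [fourier_spline_cons, norm_mul, mul_assoc]
    exact mul_le_mul (VectorFourier.norm_fourierIntegral_le_integral_norm _ _ _ _ _) (hC ξ)
      (by positivity) (integral_nonneg fun _ => norm_nonneg _)

/-- Two nodes give two factors of decay 1/(1 + |ξ|), enough for Fourier inversion. -/
theorem integrable_fourier_spline_cons (l₀ l : ℝ) (L : List ℝ) :
    Integrable (𝓕 (spline l₀ (l :: L))) := by
  obtain ⟨C, hC⟩ := exists_norm_fourier_spline_mul_le l₀ L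
  set K := (∫ v, ‖kernel l v‖) + (Real.exp (-l) + 1) with hK
  have hcont : Continuous (𝓕 (spline l₀ (l :: L))) :=
    VectorFourier.fourierIntegral_continuous Real.continuous_fourierChar
      (innerSL ℝ).continuous₂ (integrable_spline l₀ (l :: L))
  refine (integrable_inv_one_add_sq.const_mul (K * C)).mono' hcont.aestronglyMeasurable ?_
  refine Filter.Eventually.of_forall fun ξ => ?_
  have h1 := norm_fourier_kernel_mul_le l ξ
  have h2 := mul_le_mul h1 (hC ξ) (by positivity) (le_trans (by positivity) h1)
  rw [fourier_spline_cons, norm_mul, ← div_eq_mul_inv, le_div_iff₀ (by positivity)]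
  refine le_trans ?_ h2
  have h3 : 1 + ξ ^ 2 ≤ (1 + |ξ|) * (1 + |ξ|) := by nlinarith [abs_nonneg ξ, sq_abs ξ]
  calc _ ≤ ‖𝓕 (kernel l) ξ‖ * ‖𝓕 (spline l₀ L) ξ‖ * ((1 + |ξ|) * (1 + |ξ|)) := by gcongr
    _ = _ := by ring

/-- The TB-spline is an iterated convolution. -/
theorem tbSpline_eq_spline (l₀ l : ℝ) (L : List ℝ) :
    tbSpline (l₀ :: l :: L : List ℝ) = spline l₀ (l :: L) := by
  rw [← (continuous_spline_cons l₀ l L).fourierInv_fourier_eq (integrable_spline _ _)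
    (integrable_fourier_spline_cons l₀ l L)]
  ext t
  have h1 := Measure.integral_comp_mul_left (fun ξ : ℝ => exp (I * (ξ : ℂ) * (t : ℂ)) *
    tbSplineHat (l₀ :: l :: L : List ℝ) ξ) (2 * Real.pi)
  have h2 : ∫ ξ : ℝ, exp (I * ((2 * Real.pi * ξ : ℝ) : ℂ) * (t : ℂ)) *
      tbSplineHat (l₀ :: l :: L : List ℝ) (2 * Real.pi * ξ) =
      𝓕⁻ (𝓕 (spline l₀ (l :: L))) t := by
    rw [Real.fourierInv_eq']
    refine integral_congr_ae ?_
    -- At ξ = 0 a node 0 makes the symbol the default value 0/0 = 0, so this null set is discarded.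
    filter_upwards [Measure.ae_ne volume (0 : ℝ)] with ξ hξ
    rw [fourier_spline l₀ (l :: L) hξ, smul_eq_mul]
    congr 2
    simp only [RCLike.inner_apply, conj_trivial]
    push_cast
    ring
  rw [← h2, h1, tbSpline, abs_of_pos (by positivity), real_smul]
  push_cast
  rw [one_div]

theorem eulerSchoenberg_zero_eq_period (l₀ l : ℝ) (L : List ℝ) (z : ℂ) :
    eulerSchoenberg (l₀ :: l :: L : List ℝ) 0 z = period z⁻¹ l₀ (l :: L) 0 := by
  rw [eulerSchoenberg, tbSpline_eq_spline, ← tsum_spline_neg]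
  simp only [zero_sub]

end Fourier

theorem phiStar_eq_eulerSchoenberg (Λ : Multiset ℝ) (ξ : ℝ) :
    phiStar (tbSpline Λ) ξ = eulerSchoenberg Λ 0 (exp (I * ξ)) := by
  rw [phiStar, eulerSchoenberg, ← (Equiv.neg ℤ).tsum_eq]
  refine tsum_congr fun j => ?_
  rw [Equiv.neg_apply, ← exp_int_mul, zero_sub, mul_comm]
  congr 2 <;> push_cast <;> ring

/-! ### Ordering the nodes of Λ_k. -/

section Nodes

/-- The integers `a, a + 2, …, a + 2 (p - 1)`. -/
def evenSteps (a : ℤ) (p : ℕ) : List ℤ := (List.range p).map fun j : ℕ => a + 2 * (j : ℤ)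

theorem coe_evenSteps_succ (a : ℤ) (p : ℕ) :
    (evenSteps a (p + 1) : Multiset ℤ) = {a + 2 * (p : ℤ)} + evenSteps a p := by
  rw [evenSteps, List.range_succ, List.map_append, ← Multiset.coe_add, add_comm]
  rfl

theorem coe_evenSteps_succ' (a : ℤ) (p : ℕ) :
    (evenSteps a (p + 1) : Multiset ℤ) = {a} + evenSteps (a + 2) p := by
  rw [evenSteps, List.range_succ_eq_map, List.map_cons, List.map_map, Multiset.singleton_add,
    Multiset.cons_coe, evenSteps]
  congr 2
  · simp
  · refine List.map_congr_left fun j _ => ?_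
    simp only [Function.comp_apply]
    push_cast
    ring

theorem mem_evenSteps {a : ℤ} {p : ℕ} {μ : ℤ} (h : μ ∈ evenSteps a p) :
    a ≤ μ ∧ μ + 2 ≤ a + 2 * p := by
  obtain ⟨j, hj, rfl⟩ := List.mem_map.mp h
  rw [List.mem_range] at hj
  omega

theorem count_evenSteps_append_le_two (a b : ℤ) (p q : ℕ) (μ : ℤ) :
    (evenSteps a p ++ evenSteps b q).count μ ≤ 2 := by
  have h : ∀ (a : ℤ) (p : ℕ), (evenSteps a p).count μ ≤ 1 := fun a p =>
    List.nodup_iff_count_le_one.mp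
      (List.nodup_range.map fun i j hij => by omega) μ
  rw [List.count_append]
  exact add_le_add (h a p) (h b q)

theorem even_length_evenSteps_append (a b : ℤ) (p : ℕ) :
    Even (evenSteps a p ++ evenSteps b p).length := by
  simp [evenSteps]

/-- If a < b, the extremes a and b + 2q are simple with 2q inner nodes. If a = b, every node is
double; the pair a, a is treated directly, since it has no two distinct extremes. -/
theorem exists_list_of_le {a b : ℤ} (hab : a ≤ b) (q : ℕ) :
    ∃ (M : ℤ) (L : List ℤ), L ≠ [] ∧
      (evenSteps a (q + 1) + evenSteps b (q + 1) : Multiset ℤ) = (M :: L : List ℤ) ∧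
      period (-1) M (L.map (Int.cast : ℤ → ℝ)) 0 ≠ 0 := by
  rcases hab.lt_or_eq with hab | rfl
  · refine ⟨b + 2 * q, (evenSteps (a + 2) q ++ evenSteps b q) ++ [a], by simp, ?_,
      period_neg_one_simple_ne_zero (by omega) _ (fun μ hμ => ?_)
        (count_evenSteps_append_le_two _ _ _ _) (even_length_evenSteps_append _ _ _)⟩
    · rw [coe_evenSteps_succ' a, coe_evenSteps_succ b, ← Multiset.cons_coe, ← Multiset.coe_add,
        ← Multiset.coe_add, ← Multiset.singleton_add, Multiset.coe_singleton]
      abel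
    · rcases List.mem_append.mp hμ with h | h
      · have := mem_evenSteps h; omega
      · have := mem_evenSteps h; omega
  · obtain _ | r := q
    · exact ⟨a, [a], by simp, by simp [evenSteps]; rfl, period_pair_ne_zero (by simp) _ _⟩
    · refine ⟨a + 2 * (r + 1 : ℕ), (evenSteps (a + 2) r ++ evenSteps (a + 2) r) ++
        [a, a, a + 2 * (r + 1 : ℕ)], by simp, ?_,
        period_neg_one_double_ne_zero (by omega) _ (fun μ hμ => ?_)
          (count_evenSteps_append_le_two _ _ _ _) (even_length_evenSteps_append _ _ _)⟩
      · have h : (([a, a, a + 2 * (r + 1 : ℕ)] : List ℤ) : Multiset ℤ) =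
            {a} + ({a} + {a + 2 * ((r + 1 : ℕ) : ℤ)}) := rfl
        have h' : (evenSteps a (r + 1 + 1) : Multiset ℤ) =
            {a + 2 * ((r + 1 : ℕ) : ℤ)} + ({a} + evenSteps (a + 2) r) := by
          rw [coe_evenSteps_succ, coe_evenSteps_succ']
        rw [h', ← Multiset.cons_coe, ← Multiset.coe_add, ← Multiset.coe_add,
          ← Multiset.singleton_add, h]
        abel
      · have h : μ ∈ evenSteps (a + 2) r := by simpa using hμ
        have := mem_evenSteps h
        push_cast
        omega

theorem exists_list (a b : ℤ) (q : ℕ) :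
    ∃ (M : ℤ) (L : List ℤ), L ≠ [] ∧
      (evenSteps a (q + 1) + evenSteps b (q + 1) : Multiset ℤ) = (M :: L : List ℤ) ∧
      period (-1) M (L.map (Int.cast : ℤ → ℝ)) 0 ≠ 0 := by
  rcases le_total a b with h | h
  · exact exists_list_of_le h q
  · rw [add_comm]
    exact exists_list_of_le h q

theorem nearlySymmetric_eq_map (n p : ℕ) (k : ℤ) :
    nearlySymmetric n p k =
      ((evenSteps k p + evenSteps (-n - k + 2) p : Multiset ℤ)).map (Int.cast : ℤ → ℝ) := by
  simp [nearlySymmetric, evenSteps, Multiset.range, Function.comp_def]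

end Nodes

/-! ### Assembly over the unit circle. -/

theorem period_ne_zero_of_norm_eq_one {z : ℂ} (hz : ‖z‖ = 1) {l₀ : ℝ} {L : List ℝ}
    (h : period (-1) l₀ L 0 ≠ 0) : period z l₀ L 0 ≠ 0 := by
  by_cases him : z.im = 0
  · have hre : z = z.re := Complex.ext rfl (by simp [him])
    rw [hre, norm_real, Real.norm_eq_abs] at hz
    rcases eq_or_eq_neg_of_abs_eq hz with h1 | h1
    · rw [hre, h1, ofReal_one]
      intro h0
      have := re_period_one_pos l₀ L (x := 0) (by simp)
      rw [h0] at this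
      simp at this
    · rwa [hre, h1, ofReal_neg, ofReal_one]
  · exact period_ne_zero_of_im_ne_zero him l₀ L

theorem eulerSchoenberg_nearlySymmetric_ne_zero (n : ℕ) {p : ℕ} (hp : 1 ≤ p) (k : ℤ) {z : ℂ}
    (hz : ‖z‖ = 1) : eulerSchoenberg (nearlySymmetric n p k) 0 z ≠ 0 := by
  obtain ⟨q, rfl⟩ : ∃ q, p = q + 1 := ⟨p - 1, by omega⟩
  obtain ⟨M, L, hL, heq, hne⟩ := exists_list k (-n - k + 2) q
  obtain ⟨l, L, rfl⟩ := List.exists_cons_of_ne_nil hL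
  rw [nearlySymmetric_eq_map, heq, Multiset.map_coe, List.map_cons, List.map_cons,
    eulerSchoenberg_zero_eq_period]
  exact period_ne_zero_of_norm_eq_one (by rw [norm_inv, hz, inv_one]) hne

end ExpSpline

theorem mainTheorem6 (n p : ℕ) (hn : 1 ≤ n) (hp : 1 ≤ p) (k : ℤ) :
    (∀ ξ : ℝ,
      ExpSpline.phiStar (ExpSpline.tbSpline (ExpSpline.nearlySymmetric n p k)) ξ ≠ 0) ∧
    (∀ ξ : ℝ,
      ExpSpline.phiStar (ExpSpline.tbSpline (ExpSpline.nearlySymmetric n p k)) ξ =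
        ExpSpline.eulerSchoenberg (ExpSpline.nearlySymmetric n p k) 0
          (Complex.exp (Complex.I * (ξ : ℂ)))) ∧
    (∀ z : ℂ, ‖z‖ = 1 →
      ExpSpline.eulerSchoenberg (ExpSpline.nearlySymmetric n p k) 0 z ≠ 0) := by
  refine ⟨fun ξ => ?_, fun ξ => ExpSpline.phiStar_eq_eulerSchoenberg _ ξ,
    fun z hz => ExpSpline.eulerSchoenberg_nearlySymmetric_ne_zero n hp k hz⟩
  rw [ExpSpline.phiStar_eq_eulerSchoenberg]
  exact ExpSpline.eulerSchoenberg_nearlySymmetric_ne_zero n hp k (by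
    rw [mul_comm, Complex.norm_exp_ofReal_mul_I])
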